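/- Simplicial complexes are finite, contain the empty face $\varnothing$, and not every element of the vertex set has to be a vertex of the complex. For a simplicial complex $K$ on $[m]=\{1,\dots,m\}$ and an $m$-tuple $\underline f=(f_1,\dots,f_m)$ of maps $f_i\colon X_i\to A_i$ of pointed topological spaces, the polyhedral coproduct is the homotopy limit $$\underline f^K_{\mathrm{co}}=\operatorname*{holim}_{\sigma\in \mathrm{cat}(K)^{\mathrm{op}}}\ \bigvee_{i=1}^m Y_i(\sigma),\qquad Y_i(\sigma)=\begin{cases}X_i & i\in\sigma\\ A_i& i\notin\sigma,\end{cases}$$ where $\mathrm{cat}(K)$ is the poset of faces of $K$ (including $\varnothing$) ordered by inclusion, and for $\tau\subset\sigma$ the map $\bigvee_i Y_i(\sigma)\to\bigvee_i Y_i(\tau)$ is the wedge of the maps $f_i$ for $i\in\sigma\setminus\tau$ and of identity maps for the other $i$. The homotopy limit of a diagram $D$ over a finite poset $J$ is given by the Bousfield–Kan formula, as the space of natural transformations from $j\mapsto |N(J/j)|$ to $D$. An inclusion $L\subset K$ of simplicial complexes on $[m]$ induces a map $\underline f^K_{\mathrm{co}}\to\underline f^L_{\mathrm{co}}$ by restriction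 along $\mathrm{cat}(L)^{\mathrm{op}}\to\mathrm{cat}(K)^{\mathrm{op}}$. **Proposition.** Let $n<m$ and $1\le l\le m$. Let $K_1$ be a simplicial complex on $\{1,\dots,n\}$, $K_2$ a simplicial complex on $\{l,\dots,m\}$, and $L$ a simplicial complex on $\{l,\dots,n\}$ (possibly with no vertices). For $M$ one of $K_1,K_2,L$, let $\overline M$ be $M$ considered on the vertex set $[m]$. Suppose that $L$ is the intersection of $K_1$ and $K_2$, i.e. $\overline L=\overline{K_1}\cap\overline{K_2}$, and let $K=K_1\cup_L K_2=\overline{K_1}\cup\overline{K_2}$ be the simplicial complex on $[m]$ obtained by gluing $K_1$ and $K_2$ along $L$. Then for every $m$-tuple $\underline f$ of maps $f_i\colon X_i\to A_i$ of pointed topological spaces, the square $$\begin{array}{ccc}\underline f^{K}_{\mathrm{co}}&\longrightarrow&\underline f^{\overline{K_2}}_{\mathrm{co}}\\ \downarrow&&\downarrow\\ \underline f^{\overline{K_1}}_{\mathrm{co}}&\longrightarrow&\underline f^{\overline{L}}_{\mathrm{co}}\end{array}$$ of maps induced by the simplicial inclusions is a homotopy pullback: it commutes, and the induced map from $\underline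 f^{K}_{\mathrm{co}}$ to the space of triples $(x,y,\gamma)$, with $x\in\underline f^{\overline{K_1}}_{\mathrm{co}}$, $y\in\underline f^{\overline{K_2}}_{\mathrm{co}}$ and $\gamma$ a path in $\underline f^{\overline{L}}_{\mathrm{co}}$ from the image of $x$ to the image of $y$, is a pointed homotopy equivalence. -/

import Mathlib

open CategoryTheory

universe u

/-! ## Pointed topological spaces -/

/-- A pointed topological space. -/
structure PtdTop : Type (u + 1) where
  carrier : Type u
  [top : TopologicalSpace carrier]
  pt : carrier

namespace PtdTop

instance : CoeSort PtdTop.{u} (Type u) := ⟨PtdTop.carrier⟩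

instance (X : PtdTop.{u}) : TopologicalSpace X := X.top

/-- A pointed map: a continuous map that preserves the base points. -/
@[ext]
structure Hom (X Y : PtdTop.{u}) : Type u where
  toMap : C(X, Y)
  map_pt : toMap X.pt = Y.pt

/-- The category of pointed topological spaces. -/
instance : Category PtdTop.{u} where
  Hom := Hom
  id X := ⟨ContinuousMap.id X, rfl⟩
  comp f g := ⟨g.toMap.comp f.toMap, by simp [f.map_pt, g.map_pt]⟩

@[simp] theorem id_toMap (X : PtdTop.{u}) : Hom.toMap (𝟙 X) = ContinuousMap.id X := rfl

@[simp] theorem comp_toMap {X Y Z : PtdTop.{u}} (f : X ⟶ Y) (g : Y ⟶ Z) :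
    Hom.toMap (f ≫ g) = g.toMap.comp f.toMap := rfl

@[ext] theorem hom_ext {X Y : PtdTop.{u}} {f g : X ⟶ Y} (h : ∀ x, f.toMap x = g.toMap x) :
    f = g :=
  Hom.ext (ContinuousMap.ext h)

/-- A pointed homotopy equivalence: a pointed map with an inverse up to homotopies that fix the
base points. -/
def IsHomotopyEquiv {X Y : PtdTop.{u}} (f : X ⟶ Y) : Prop :=
  ∃ g : Y ⟶ X,
    ContinuousMap.HomotopicRel (f ≫ g).toMap (ContinuousMap.id X) {X.pt} ∧
    ContinuousMap.HomotopicRel (g ≫ f).toMap (ContinuousMap.id Y) {Y.pt}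

/-! ### Wedges -/

section Wedge

variable {ι : Type}

/-- The relation on the disjoint union of a point and the `X i` that identifies every base point with the extra point. -/
inductive WedgeRel (X : ι → PtdTop.{u}) :
    (PUnit.{u + 1} ⊕ (Σ i, X i)) → (PUnit.{u + 1} ⊕ (Σ i, X i)) → Prop
  | glue (i : ι) : WedgeRel X (Sum.inr ⟨i, (X i).pt⟩) (Sum.inl PUnit.unit)

/-- The wedge `⋁ i, X i`: the disjoint union of the `X i` with all base points identified (and
a single point when there are no `X i`), with the quotient topology. -/
def wedge (X : ι → PtdTop.{u}) : PtdTop.{u} where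
  carrier := Quot (WedgeRel X)
  pt := Quot.mk _ (Sum.inl PUnit.unit)

/-- The map of disjoint unions underlying a wedge of maps. -/
def wedgeMapAux {X Y : ι → PtdTop.{u}} (g : ∀ i, X i ⟶ Y i) :
    (PUnit.{u + 1} ⊕ (Σ i, X i)) → (PUnit.{u + 1} ⊕ (Σ i, Y i)) :=
  Sum.map id (Sigma.map id fun i => (g i).toMap)

/-- The wedge `⋁ i, g i` of a family of pointed maps. -/
def wedgeMap {X Y : ι → PtdTop.{u}} (g : ∀ i, X i ⟶ Y i) : wedge X ⟶ wedge Y where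
  toMap :=
    { toFun := Quot.map (wedgeMapAux g) (by
        rintro _ _ ⟨i⟩
        have h : wedgeMapAux g (Sum.inr ⟨i, (X i).pt⟩) = Sum.inr ⟨i, (Y i).pt⟩ := by
          simp [wedgeMapAux, Sigma.map, (g i).map_pt]
        rw [h]
        exact WedgeRel.glue i)
      continuous_toFun := by
        refine continuous_quot_lift _ (continuous_quot_mk.comp ?_)
        exact continuous_id.sumMap (Continuous.sigma_map fun i => (g i).toMap.continuous) }
  map_pt := rfl

theorem wedgeMap_id (X : ι → PtdTop.{u}) : wedgeMap (fun i => 𝟙 (X i)) = 𝟙 (wedge X) := by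
  ext x
  rcases x with ⟨_ | ⟨i, x⟩⟩ <;> rfl

theorem wedgeMap_comp {X Y Z : ι → PtdTop.{u}} (g : ∀ i, X i ⟶ Y i) (h : ∀ i, Y i ⟶ Z i) :
    wedgeMap (fun i => g i ≫ h i) = wedgeMap g ≫ wedgeMap h := by
  ext x
  rcases x with ⟨_ | ⟨i, x⟩⟩ <;> rfl

end Wedge

/-! ### Homotopy pullbacks -/

section HomotopyPullback

variable {P X Y Z : PtdTop.{u}}

/-- The standard homotopy pullback (double mapping path space) of `g : X ⟶ Z` and `h : Y ⟶ Z`: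
triples `(x, y, γ)` of points `x`, `y` and a path `γ` in `Z` from `g x` to `h y`. -/
def hoPullback (g : X ⟶ Z) (h : Y ⟶ Z) : PtdTop.{u} where
  carrier := {w : (X × Y) × C(unitInterval, Z) // w.2 0 = g.toMap w.1.1 ∧ w.2 1 = h.toMap w.1.2}
  pt := ⟨((X.pt, Y.pt), ContinuousMap.const unitInterval Z.pt), g.map_pt.symm, h.map_pt.symm⟩

/-- The map from the corner of a commutative square to the homotopy pullback, by constant
paths. -/
def toHoPullback {a : P ⟶ X} {b : P ⟶ Y} {g : X ⟶ Z} {h : Y ⟶ Z} (w : a ≫ g = b ≫ h) :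
    P ⟶ hoPullback g h where
  toMap :=
    { toFun := fun p => ⟨((a.toMap p, b.toMap p), ContinuousMap.const unitInterval (g.toMap (a.toMap p))),
        rfl, congrArg (fun k : P ⟶ Z => k.toMap p) w⟩
      continuous_toFun := by
        refine Continuous.subtype_mk (Continuous.prodMk (by fun_prop) ?_) _
        exact ContinuousMap.continuous_const'.comp (by fun_prop) }
  map_pt := by
    have h₁ := a.map_pt
    have h₂ := b.map_pt
    have h₃ := g.map_pt
    refine Subtype.ext ?_
    change ((a.toMap P.pt, b.toMap P.pt),
      ContinuousMap.const unitInterval (g.toMap (a.toMap P.pt))) = _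
    rw [h₁, h₂, h₃]
    rfl

/-- The square with top map `b : P ⟶ Y`, left map `a : P ⟶ X`, right map `h : Y ⟶ Z` and bottom map
`g : X ⟶ Z` is a homotopy pullback: it commutes, and the comparison map from `P` to the homotopy
pullback of `g` and `h` is a pointed homotopy equivalence. -/
def IsHomotopyPullback (b : P ⟶ Y) (a : P ⟶ X) (h : Y ⟶ Z) (g : X ⟶ Z) : Prop :=
  ∃ w : a ≫ g = b ≫ h, IsHomotopyEquiv (toHoPullback w)

end HomotopyPullback

end PtdTop

/-! ## Homotopy limits over finite posets -/

namespace HoLim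

open PtdTop

variable {J : Type} [Fintype J] [PartialOrder J]

/-- The geometric realization `|N(J / j)|` of the nerve of the slice category `J / j = {i ≤ j}` of
a finite poset `J`, that is, of the simplicial complex of chains in `{i ≤ j}`. A point is given by
its barycentric coordinates: nonnegative weights on `J` of sum one, whose support is a chain of
elements below `j`. -/
def Slice (j : J) : Type :=
  {t : stdSimplex ℝ J // IsChain (· ≤ ·) {i | t i ≠ 0} ∧ ∀ i, t i ≠ 0 → i ≤ j}

instance (j : J) : TopologicalSpace (Slice j) :=
  inferInstanceAs (TopologicalSpace
    {t : stdSimplex ℝ J // IsChain (· ≤ ·) {i | t i ≠ 0} ∧ ∀ i, t i ≠ 0 → i ≤ j})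

/-- The inclusion `|N(J / i)| → |N(J / j)|` for `i ≤ j`. -/
def Slice.incl {i j : J} (h : i ≤ j) : C(Slice i, Slice j) where
  toFun t := ⟨t.1, t.2.1, fun k hk => (t.2.2 k hk).trans h⟩
  continuous_toFun := Continuous.subtype_mk continuous_subtype_val _

/-- The homotopy limit of a diagram `D` of pointed spaces over a finite poset `J`, by the
Bousfield-Kan formula: the space of natural transformations from `j ↦ |N(J / j)|` to `D`, as a
subspace of the product over `j` of the mapping spaces (with the compact-open topology) from
`|N(J / j)|` to `D j`. The base point is the family of constant maps. -/
def holim (D : J ⥤ PtdTop.{u}) : PtdTop.{u} where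
  carrier := {φ : ∀ j : J, C(Slice j, D.obj j) //
    ∀ (i j : J) (h : i ≤ j) (t : Slice i),
      (D.map (homOfLE h)).toMap (φ i t) = φ j (Slice.incl h t)}
  pt := ⟨fun j => ContinuousMap.const _ (D.obj j).pt, fun _ _ h _ => (D.map (homOfLE h)).map_pt⟩

variable {I : Type} [Fintype I] [PartialOrder I]

theorem exists_of_map_ne_zero {I J : Type} [Fintype I] [Fintype J] (v : I → J) (t : stdSimplex ℝ I) (j : J)
    (hj : stdSimplex.map v t j ≠ 0) : ∃ k, v k = j ∧ t k ≠ 0 := by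
  classical
  rw [stdSimplex.map_coe, FunOnFinite.linearMap_apply_apply] at hj
  obtain ⟨k, hk, hk'⟩ := Finset.exists_ne_zero_of_sum_ne_zero hj
  exact ⟨k, by simpa using hk, hk'⟩

theorem map_mem_slice (v : I →o J) (i : I) (t : Slice i) :
    IsChain (· ≤ ·) {j | stdSimplex.map v t.1 j ≠ 0} ∧
      ∀ j, stdSimplex.map v t.1 j ≠ 0 → j ≤ v i := by
  refine ⟨?_, ?_⟩
  · intro j hj j' hj' _
    obtain ⟨k, rfl, hk⟩ := exists_of_map_ne_zero v t.1 j hj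
    obtain ⟨k', rfl, hk'⟩ := exists_of_map_ne_zero v t.1 j' hj'
    exact (t.2.1.total hk hk').imp (fun h => v.monotone h) (fun h => v.monotone h)
  · intro j hj
    obtain ⟨k, rfl, hk⟩ := exists_of_map_ne_zero v t.1 j hj
    exact v.monotone (t.2.2 k hk)

/-- The map `|N(I / i)| → |N(J / v i)|` induced by a monotone map `v : I → J`. -/
noncomputable def Slice.map (v : I →o J) (i : I) : C(Slice i, Slice (v i)) where
  toFun t := ⟨stdSimplex.map v t.1, map_mem_slice v i t⟩
  continuous_toFun :=
    Continuous.subtype_mk ((stdSimplex.continuous_map v).comp continuous_subtype_val) _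

/-- The canonical map `holim D → holim (D ∘ v)` of a monotone map `v : I → J`, by restriction. -/
noncomputable def restrict (v : I →o J) (D : J ⥤ PtdTop.{u}) :
    holim D ⟶ holim (v.monotone.functor ⋙ D) where
  toMap :=
    { toFun := fun φ => ⟨fun i => (φ.1 (v i)).comp (Slice.map v i), fun i j h t =>
        φ.2 (v i) (v j) (v.monotone h) (Slice.map v i t)⟩
      continuous_toFun := by
        refine Continuous.subtype_mk (continuous_pi fun i => ?_) _
        exact (ContinuousMap.continuous_precomp _).comp
          ((continuous_apply (v i)).comp continuous_subtype_val) }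
  map_pt := rfl

end HoLim

/-! ## Polyhedral coproducts -/

/-- The faces of a simplicial complex `K`, including the empty face, ordered by inclusion: the
objects of the face poset `cat(K)`. Mathlib's simplicial complexes record the nonempty faces only;
not every element of `ι` has to be a vertex of `K`. -/
abbrev PreAbstractSimplicialComplex.FacePoset {ι : Type} (K : PreAbstractSimplicialComplex ι) :
    Type :=
  {σ : Finset ι // σ = ∅ ∨ σ ∈ K}

namespace PolyhedralCoproduct

open PtdTop HoLim

variable {ι : Type} [Fintype ι] [DecidableEq ι]

noncomputable instance (K : PreAbstractSimplicialComplex ι) : Fintype K.FacePoset :=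
  Fintype.ofFinite _

section Diagram

/-- The space `X` (for `true`) or `A` (for `false`). -/
def Y (X A : PtdTop.{u}) : Bool → PtdTop.{u}
  | true => X
  | false => A

/-- For `c ≤ b`, the map from `Y X A b` to `Y X A c` which is `f : X ⟶ A` if `b` is true and `c` is
false, and an identity otherwise. -/
def yMap {X A : PtdTop.{u}} (f : X ⟶ A) : ∀ b c : Bool, c ≤ b → (Y X A b ⟶ Y X A c)
  | true, true, _ => 𝟙 X
  | true, false, _ => f
  | false, false, _ => 𝟙 A
  | false, true, h => absurd h (by decide)

theorem yMap_id {X A : PtdTop.{u}} (f : X ⟶ A) (b : Bool) : yMap f b b le_rfl = 𝟙 _ := by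
  cases b <;> rfl

theorem yMap_comp {X A : PtdTop.{u}} (f : X ⟶ A) (b c d : Bool) (h : c ≤ b) (h' : d ≤ c) :
    yMap f b d (h'.trans h) = yMap f b c h ≫ yMap f c d h' := by
  cases b <;> cases c <;> cases d <;> first | rfl | exact absurd h (by decide) |
    exact absurd h' (by decide)

theorem decide_mem_le {ι : Type} [DecidableEq ι] {σ τ : Finset ι} (h : τ ⊆ σ) (i : ι) :
    decide (i ∈ τ) ≤ decide (i ∈ σ) := by
  by_cases hi : i ∈ τ
  · simp [hi, h hi]
  · simp [hi]

variable {X A : ι → PtdTop.{u}} (f : ∀ i, X i ⟶ A i)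

/-- The diagram `σ ↦ ⋁ i, Y i σ`, where `Y i σ` is `X i` if `i ∈ σ` and `A i` if `i ∉ σ`, on all
finite sets `σ`, ordered by reverse inclusion. For `τ ⊆ σ` the map `⋁ i, Y i σ ⟶ ⋁ i, Y i τ` is the
wedge of the maps `f i` for `i ∈ σ \ τ` and of identities for the other `i`. -/
def wedgeDiagram : (Finset ι)ᵒᵈ ⥤ PtdTop.{u} where
  obj σ := wedge fun i => Y (X i) (A i) (decide (i ∈ OrderDual.ofDual σ))
  map {_ _} h := wedgeMap fun i => yMap (f i) _ _ (decide_mem_le (OrderDual.ofDual_le_ofDual.2 h.le) i)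
  map_id _ := by simp only [yMap_id]; exact wedgeMap_id _
  map_comp h h' := by
    rw [← wedgeMap_comp]
    exact congrArg wedgeMap (funext fun i => yMap_comp (f i) _ _ _ _ _)

end Diagram

/-- The underlying set of a face, as a map from the opposite of `cat(K)`. -/
def vertices (K : PreAbstractSimplicialComplex ι) : K.FacePosetᵒᵈ →o (Finset ι)ᵒᵈ where
  toFun σ := OrderDual.toDual (OrderDual.ofDual σ).1
  monotone' _ _ h := h

variable {X A : ι → PtdTop.{u}} (f : ∀ i, X i ⟶ A i)

/-- The diagram `D : cat(K)ᵒᵖ ⥤ PtdTop`, `D(σ) = ⋁ i, Y i σ`. -/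
def diagram (K : PreAbstractSimplicialComplex ι) : K.FacePosetᵒᵈ ⥤ PtdTop.{u} :=
  (vertices K).monotone.functor ⋙ wedgeDiagram f

/-- The polyhedral coproduct of the maps `f i : X i ⟶ A i` over a simplicial complex `K` on the
vertex set `ι`. -/
noncomputable def polyhedralCoproduct (K : PreAbstractSimplicialComplex ι) : PtdTop.{u} :=
  holim (diagram f K)

/-- The inclusion `cat(L)ᵒᵖ → cat(K)ᵒᵖ` of a subcomplex `L` of `K`. -/
def faceInclusion {L K : PreAbstractSimplicialComplex ι} (h : L ≤ K) :
    L.FacePosetᵒᵈ →o K.FacePosetᵒᵈ where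
  toFun σ := OrderDual.toDual ⟨(OrderDual.ofDual σ).1, (OrderDual.ofDual σ).2.imp id fun hσ => h hσ⟩
  monotone' _ _ h := h

/-- The map of polyhedral coproducts induced by a simplicial inclusion `L ≤ K`, restricting
from `cat(K)ᵒᵖ` to `cat(L)ᵒᵖ`. -/
noncomputable def mapOfLE {L K : PreAbstractSimplicialComplex ι} (h : L ≤ K) :
    polyhedralCoproduct f K ⟶ polyhedralCoproduct f L :=
  restrict (faceInclusion h) (diagram f K)

end PolyhedralCoproduct

/-- A simplicial complex on `{a, …, b}`, considered on a larger vertex set `{a', …, b'}`. -/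
def PreAbstractSimplicialComplex.extend {a b : ℕ} (K : PreAbstractSimplicialComplex (Set.Icc a b))
    (a' b' : ℕ) (ha : a' ≤ a) (hb : b ≤ b') : PreAbstractSimplicialComplex (Set.Icc a' b') :=
  K.map (Set.inclusion (Set.Icc_subset_Icc ha hb))

/-!
The homotopy limit over `J = cat(K)ᵒᵖ` is the space of natural transformations from the slice
realizations `|N(J / σ)|` to the diagram. Subcomplexes of `K` are upper sets of `J`, so a chain
whose smallest element lies in `cat(K₁)ᵒᵖ` lies there entirely. If `K = K₁ ∪ K₂`, every chain
therefore lies in `cat(K₁)ᵒᵖ` or in `cat(K₂)ᵒᵖ`, and `|N(J / σ)|` is the union of the two slice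
realizations with respect to `K₁` and `K₂`, which meet in that with respect to `L`. Hence the
polyhedral coproduct over `K` is the strict pullback of those over `K₁` and `K₂`
(`PolyhedralCoproduct.glue`).

It remains to see that the restriction from `K₁` to `L` is a fibration in a pointed sense. For a
point `t` of a slice of `K₁` let `b` be the total weight of the vertices in `cat(L)ᵒᵖ`
(`Slice.mass`). Where `b ≠ 0`, deleting the other vertices and normalizing gives a point of a
slice of `L` (`Slice.proj`), and there is a natural deformation `Slice.stretch` of the slices of
`K₁` whose end map is this projection where `1 / 2 ≤ b`. A path `γ` of points over `L` from the
restriction of `x` is lifted, at time `s`, by `γ (max (s - 2 (1 - b)) 0)` on the projection of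
`t` where `1 / 2 ≤ b`, and by `x` on the stretched point elsewhere
(`PolyhedralCoproduct.weakPathLifting`). The lift starts at the stretched `x` rather than at `x`,
but the two are joined by a homotopy that does not change the restriction to `L`. All formulas
are precompositions, so they preserve constant families and the base points. By
`PtdTop.isHomotopyPullback_of_weakPathLifting`, a strict pullback along a map with such liftings
is a homotopy pullback in the pointed sense.
-/

/-! ### Weak path lifting and homotopy pullbacks -/

namespace PtdTop

open unitInterval

variable {P X Y Z : PtdTop.{u}}

/-- The pairs of a point `x` of `X` and a path in `Z` that starts at `g x`. -/
abbrev PathProblem (g : X ⟶ Z) : Type u :=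
  {w : X × C(I, Z) // w.2 0 = g.toMap w.1}

/-- A pointed weak path lifting function for `g : X ⟶ Z`. The lift of a path starting at `g x` need
not start at `x` itself: it starts at the end point of the track of `x` under a fibrewise homotopy
`drift`. Constant paths at the base point lift to constant paths, and `drift` fixes the base point.
For such `g` the strict pullback is already a homotopy pullback. -/
structure WeakPathLifting (g : X ⟶ Z) where
  lift : C(PathProblem g × I, X)
  drift : C(X × I, X)
  map_lift : ∀ w s, g.toMap (lift (w, s)) = w.1.2 s
  map_drift : ∀ x s, g.toMap (drift (x, s)) = g.toMap x
  drift_zero : ∀ x, drift (x, 0) = x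
  lift_zero : ∀ w, lift (w, 0) = drift (w.1.1, 1)
  lift_pt : ∀ (w : PathProblem g) s, w.1 = (X.pt, ContinuousMap.const I Z.pt) →
    lift (w, s) = X.pt
  drift_pt : ∀ s, drift (X.pt, s) = X.pt

/-- The final part of the path `γ`, from parameter `s` on: it waits at `γ s` until time `s`. -/
def pathTail (γ : C(I, Z)) (s : I) : C(I, Z) where
  toFun r := γ (s ⊔ r)

theorem continuous_pathTail {T : Type*} [TopologicalSpace T] {γ : T → C(I, Z)} {s : T → I}
    (hγ : Continuous γ) (hs : Continuous s) : Continuous fun a => pathTail (γ a) (s a) := by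
  refine ContinuousMap.continuous_of_continuous_uncurry _ ?_
  change Continuous fun p : T × I => γ p.1 (s p.1 ⊔ p.2)
  fun_prop

/-- If `P` is the strict pullback of `g` and `h`, and `g` has weak path liftings, then the square
is a homotopy pullback. -/
theorem isHomotopyPullback_of_weakPathLifting {a : P ⟶ X} {b : P ⟶ Y} {g : X ⟶ Z} {h : Y ⟶ Z}
    (w : a ≫ g = b ≫ h) (E : WeakPathLifting g)
    (glue : C({q : X × Y // g.toMap q.1 = h.toMap q.2}, P))
    (map_glue_left : ∀ q, a.toMap (glue q) = q.1.1)
    (map_glue_right : ∀ q, b.toMap (glue q) = q.1.2)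
    (glue_map : ∀ (p : P) (q : {q : X × Y // g.toMap q.1 = h.toMap q.2}),
      q.1 = (a.toMap p, b.toMap p) → glue q = p) :
    IsHomotopyPullback b a h g := by
  have hw : ∀ p, g.toMap (a.toMap p) = h.toMap (b.toMap p) := fun p =>
    congrArg (fun k : P ⟶ Z => k.toMap p) w
  -- The homotopy inverse lifts the path and glues the end point of the lift to `y`.
  let pr : hoPullback g h → PathProblem g := fun z => ⟨(z.1.1.1, z.1.2), z.2.1⟩
  have hpr : Continuous pr := by
    refine Continuous.subtype_mk ?_ _
    fun_prop
  let inv : hoPullback g h ⟶ P :=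
    { toMap := glue.comp
        { toFun := fun z => ⟨(E.lift (pr z, 1), z.1.1.2), by
            rw [E.map_lift]; exact z.2.2⟩
          continuous_toFun := by
            refine Continuous.subtype_mk ?_ _
            fun_prop }
      map_pt := by
        refine glue_map _ _ (Prod.ext ?_ ?_)
        · exact (E.lift_pt _ _ rfl).trans a.map_pt.symm
        · exact b.map_pt.symm }
  let cst : C(P, PathProblem g) :=
    { toFun := fun p => ⟨(a.toMap p, ContinuousMap.const I (g.toMap (a.toMap p))), rfl⟩
      continuous_toFun := by
        refine Continuous.subtype_mk (Continuous.prodMk (by fun_prop) ?_) _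
        exact ContinuousMap.continuous_const'.comp (by fun_prop) }
  have hcst : ∀ s, E.lift (cst P.pt, s) = X.pt := fun s => by
    refine E.lift_pt _ _ (Prod.ext a.map_pt ?_)
    change ContinuousMap.const I (g.toMap (a.toMap P.pt)) = _
    rw [a.map_pt, g.map_pt]
  refine ⟨w, inv, ?_, ?_⟩
  · let mid : C(P, P) := glue.comp
      { toFun := fun p => ⟨(E.drift (a.toMap p, 1), b.toMap p), by rw [E.map_drift]; exact hw p⟩
        continuous_toFun := by
          refine Continuous.subtype_mk ?_ _
          fun_prop }
    have h₁ : ContinuousMap.HomotopicRel (ContinuousMap.id P) mid {P.pt} := by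
      refine ⟨⟨⟨glue.comp
        { toFun := fun p => ⟨(E.drift (a.toMap p.2, p.1), b.toMap p.2), by
            rw [E.map_drift]; exact hw p.2⟩
          continuous_toFun := by
            refine Continuous.subtype_mk ?_ _
            fun_prop }, ?_, ?_⟩, ?_⟩⟩
      · intro p
        exact glue_map p _ (Prod.ext (E.drift_zero _) rfl)
      · intro p
        rfl
      · rintro s x rfl
        refine glue_map _ _ (Prod.ext ?_ rfl)
        change E.drift (a.toMap P.pt, s) = a.toMap P.pt
        rw [a.map_pt, E.drift_pt]
    have h₂ : ContinuousMap.HomotopicRel mid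
        (toHoPullback w ≫ inv).toMap {P.pt} := by
      refine ⟨⟨⟨glue.comp
        { toFun := fun p => ⟨(E.lift (cst p.2, p.1), b.toMap p.2), by
            rw [E.map_lift]; exact hw p.2⟩
          continuous_toFun := by
            refine Continuous.subtype_mk ?_ _
            fun_prop }, ?_, ?_⟩, ?_⟩⟩
      · intro p
        exact congrArg glue (Subtype.ext (Prod.ext (E.lift_zero _) rfl))
      · intro p
        rfl
      · rintro s x rfl
        refine congrArg glue (Subtype.ext (Prod.ext ?_ rfl))
        change E.lift (cst P.pt, s) = E.drift (a.toMap P.pt, 1)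
        rw [hcst, a.map_pt, E.drift_pt]
    exact (h₁.trans h₂).symm
  · let mid : C(hoPullback g h, hoPullback g h) :=
      { toFun := fun z => ⟨((E.drift (z.1.1.1, 1), z.1.1.2), z.1.2), by
          rw [E.map_drift]; exact z.2⟩
        continuous_toFun := by
          refine Continuous.subtype_mk ?_ _
          fun_prop }
    have h₁ : ContinuousMap.HomotopicRel (ContinuousMap.id (hoPullback g h)) mid
        {(hoPullback g h).pt} := by
      refine ⟨⟨⟨
        { toFun := fun z => ⟨((E.drift (z.2.1.1.1, z.1), z.2.1.1.2), z.2.1.2), by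
            rw [E.map_drift]; exact z.2.2⟩
          continuous_toFun := by
            refine Continuous.subtype_mk ?_ _
            fun_prop }, ?_, ?_⟩, ?_⟩⟩
      · intro z
        exact Subtype.ext (Prod.ext (Prod.ext (E.drift_zero _) rfl) rfl)
      · intro z
        rfl
      · rintro s x rfl
        exact Subtype.ext (Prod.ext (Prod.ext (E.drift_pt s) rfl) rfl)
    have h₂ : ContinuousMap.HomotopicRel mid
        (inv ≫ toHoPullback w).toMap {(hoPullback g h).pt} := by
      refine ⟨⟨⟨
        { toFun := fun z => ⟨((E.lift (pr z.2, z.1), z.2.1.1.2), pathTail z.2.1.2 z.1), by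
            constructor
            · rw [E.map_lift]
              change z.2.1.2 (z.1 ⊔ 0) = z.2.1.2 z.1
              rw [sup_of_le_left unitInterval.nonneg']
            · change z.2.1.2 (z.1 ⊔ 1) = _
              rw [sup_of_le_right unitInterval.le_one']
              exact z.2.2.2⟩
          continuous_toFun := by
            refine Continuous.subtype_mk (Continuous.prodMk (by fun_prop) ?_) _
            exact continuous_pathTail (by fun_prop) (by fun_prop) }, ?_, ?_⟩, ?_⟩⟩
      · intro z
        refine Subtype.ext (Prod.ext (Prod.ext (E.lift_zero _) rfl) ?_)
        ext r
        change z.1.2 (0 ⊔ r) = z.1.2 r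
        rw [sup_of_le_right unitInterval.nonneg']
      · intro z
        have hq : g.toMap (E.lift (pr z, 1)) = h.toMap z.1.1.2 :=
          (E.map_lift _ _).trans z.2.2
        refine Subtype.ext (Prod.ext (Prod.ext (map_glue_left ⟨_, hq⟩).symm
          (map_glue_right ⟨_, hq⟩).symm) ?_)
        ext r
        change z.1.2 (1 ⊔ r) = g.toMap (a.toMap (glue _))
        rw [sup_of_le_left unitInterval.le_one']
        exact ((congrArg g.toMap (map_glue_left ⟨_, hq⟩)).trans (E.map_lift (pr z) 1)).symm
      · rintro s x rfl
        refine Subtype.ext (Prod.ext (Prod.ext ?_ rfl) ?_)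
        · exact (E.lift_pt _ s rfl).trans (E.drift_pt 1).symm
        · ext r
          rfl
    exact (h₁.trans h₂).symm

end PtdTop

/-! ### Retracting slices towards an upper set -/

namespace HoLim

variable {I J : Type} [Fintype I] [PartialOrder I] [Fintype J] [PartialOrder J]

instance (j : J) : T2Space (Slice j) :=
  inferInstanceAs (T2Space
    {t : stdSimplex ℝ J // IsChain (· ≤ ·) {i | t i ≠ 0} ∧ ∀ i, t i ≠ 0 → i ≤ j})

namespace Slice

theorem continuous_coord {j : J} (k : J) : Continuous fun t : Slice j => t.1 k :=
  (continuous_apply k).comp (continuous_subtype_val.comp continuous_subtype_val)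

theorem continuous_mk {T : Type*} [TopologicalSpace T] {j : J} {F : T → Slice j}
    (h : ∀ k, Continuous fun a => (F a).1 k) : Continuous F :=
  Continuous.subtype_mk (Continuous.subtype_mk (continuous_pi h) _) _

theorem ext_coord {j : J} {s t : Slice j} (h : ∀ k, s.1 k = t.1 k) : s = t :=
  Subtype.ext (stdSimplex.ext (funext h))

/-- The slices are compact: they are closed in a simplex, being cut out by the conditions that
certain products of coordinates vanish. -/
instance (j : J) : CompactSpace (Slice j) := by
  have hS : {t : stdSimplex ℝ J | IsChain (· ≤ ·) {i | t i ≠ 0} ∧ ∀ i, t i ≠ 0 → i ≤ j} =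
      (⋂ i : J, ⋂ k : J, {t : stdSimplex ℝ J | ¬ (i ≤ k ∨ k ≤ i) → t i * t k = 0}) ∩
        ⋂ i : J, {t : stdSimplex ℝ J | ¬ i ≤ j → t i = 0} := by
    ext t
    simp only [Set.mem_ofPred_eq, Set.mem_inter_iff, Set.mem_iInter]
    refine and_congr ⟨fun h i k hik => ?_, fun h i hi k hk _ => ?_⟩
      (forall_congr' fun i => not_imp_comm)
    · by_contra hne
      exact hik (h.total (left_ne_zero_of_mul hne) (right_ne_zero_of_mul hne))
    · by_contra hik
      exact mul_ne_zero hi hk (h i k hik)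
  have hc : ∀ i : J, Continuous fun t : stdSimplex ℝ J => t i := fun i =>
    (continuous_apply i).comp continuous_subtype_val
  have hclosed : IsClosed
      {t : stdSimplex ℝ J | IsChain (· ≤ ·) {i | t i ≠ 0} ∧ ∀ i, t i ≠ 0 → i ≤ j} := by
    rw [hS]
    refine (isClosed_iInter fun i => isClosed_iInter fun k => ?_).inter
      (isClosed_iInter fun i => ?_)
    · exact isClosed_imp (isOpen_const) (isClosed_eq ((hc i).mul (hc k)) continuous_const)
    · exact isClosed_imp (isOpen_const) (isClosed_eq (hc i) continuous_const)
  exact isCompact_iff_compactSpace.1 hclosed.isCompact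

variable (v : I →o J)

/-- The total weight of the vertices in the range of `v`. -/
def mass {j : J} (t : Slice j) : ℝ := ∑ i, t.1 (v i)

theorem continuous_mass {j : J} : Continuous fun t : Slice j => mass v t :=
  continuous_finsetSum _ fun i _ => continuous_coord (v i)

theorem mass_nonneg {j : J} (t : Slice j) : 0 ≤ mass v t :=
  Finset.sum_nonneg fun i _ => stdSimplex.zero_le t.1 (v i)

@[simp] theorem mass_incl {j j' : J} (h : j ≤ j') (t : Slice j) :
    mass v (incl h t) = mass v t := rfl

theorem exists_le_of_mass_ne_zero {j : J} {t : Slice j} (h : mass v t ≠ 0) : ∃ i, v i ≤ j := by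
  obtain ⟨i, -, hi⟩ := Finset.exists_ne_zero_of_sum_ne_zero h
  exact ⟨i, t.2.2 _ hi⟩

variable {v}

omit [Fintype I] [Fintype J] in
theorem injective_of_reflects (hv : ∀ i i', v i ≤ v i' → i ≤ i') :
    Function.Injective v := fun _ _ h =>
  le_antisymm (hv _ _ h.le) (hv _ _ h.ge)

open Classical in
theorem mass_eq_sum_ite (hv : ∀ i i', v i ≤ v i' → i ≤ i')
    {j : J} (t : Slice j) :
    mass v t = ∑ k, if k ∈ Set.range v then t.1 k else 0 :=
  Fintype.sum_of_injective v (injective_of_reflects hv) _ _ (fun _ hk => if_neg hk)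
    fun i => (if_pos (Set.mem_range_self i)).symm

theorem mass_le_one (hv : ∀ i i', v i ≤ v i' → i ≤ i')
    {j : J} (t : Slice j) : mass v t ≤ 1 := by
  classical
  rw [mass_eq_sum_ite hv, ← stdSimplex.sum_eq_one t.1]
  refine Finset.sum_le_sum fun k _ => ?_
  split_ifs
  · exact le_rfl
  · exact stdSimplex.zero_le t.1 k

theorem mass_eq_one_iff (hv : ∀ i i', v i ≤ v i' → i ≤ i')
    {j : J} (t : Slice j) :
    mass v t = 1 ↔ ∀ k, t.1 k ≠ 0 → k ∈ Set.range v := by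
  classical
  rw [mass_eq_sum_ite hv, ← stdSimplex.sum_eq_one t.1,
    Finset.sum_eq_sum_iff_of_le fun k _ => by
      split_ifs
      exacts [le_rfl, stdSimplex.zero_le t.1 k]]
  refine forall_congr' fun k => ?_
  by_cases hk : k ∈ Set.range v
  · simp [hk]
  · simp only [Finset.mem_univ, hk, if_false, forall_const, imp_false, not_not]
    exact eq_comm

theorem map_apply (hv : ∀ i i', v i ≤ v i' → i ≤ i')
    {i : I} (s : Slice i) (k : I) : (map v i s).1 (v k) = s.1 k := by
  classical
  change stdSimplex.map v s.1 (v k) = s.1 k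
  rw [stdSimplex.map_coe, FunOnFinite.linearMap_apply_apply,
    Finset.sum_eq_single k (fun b hb hne =>
      absurd (injective_of_reflects hv (by simpa using hb)) hne)
      (fun h => absurd (by simp) h)]

theorem map_apply_of_notMem {i : I} (s : Slice i) {k : J} (hk : k ∉ Set.range v) :
    (map v i s).1 k = 0 := by
  by_contra h
  obtain ⟨i', rfl, -⟩ := exists_of_map_ne_zero v s.1 k h
  exact hk (Set.mem_range_self i')

theorem mass_map (hv : ∀ i i', v i ≤ v i' → i ≤ i')
    {i : I} (s : Slice i) : mass v (map v i s) = 1 := by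
  simp only [mass, map_apply hv]
  exact stdSimplex.sum_eq_one s.1


theorem exists_normalized (hv : ∀ i i', v i ≤ v i' → i ≤ i') {i : I} (t : Slice (v i))
    (h : mass v t ≠ 0) : ∃ s : Slice i, ∀ k, s.1 k = t.1 (v k) / mass v t := by
  have hne : ∀ k, t.1 (v k) / mass v t ≠ 0 → t.1 (v k) ≠ 0 := fun k hk h0 => hk (by simp [h0])
  refine ⟨⟨⟨fun k => t.1 (v k) / mass v t, fun k =>
    div_nonneg (stdSimplex.zero_le t.1 _) (mass_nonneg v t), ?_⟩, ?_, ?_⟩, fun _ => rfl⟩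
  · rw [← Finset.sum_div]
    exact div_self h
  · intro k hk k' hk' _
    exact (t.2.1.total (hne k hk) (hne k' hk')).imp (hv _ _) (hv _ _)
  · intro k hk
    exact hv _ _ (t.2.2 _ (hne k hk))

instance (j : J) : Nonempty (Slice j) := by
  classical
  refine ⟨⟨stdSimplex.vertex j, ?_, ?_⟩⟩
  · intro a ha b hb hab
    have h : ∀ c, stdSimplex.vertex (S := ℝ) j c ≠ 0 → c = j := fun c hc => by
      by_contra hne
      exact hc (by simp [hne])
    exact absurd ((h a ha).trans (h b hb).symm) hab
  · intro a ha
    by_contra hne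
    exact ha (by simp [show a ≠ j from fun h => hne h.le])

variable (v) in
/-- The point of `|N(I / i)|` obtained from a point of `|N(J / v i)|` by deleting the vertices
outside the range of `v` and normalizing. It is an unspecified point when all the weight lies
outside the range of `v`. -/
noncomputable def proj (i : I) (t : Slice (v i)) : Slice i :=
  Classical.epsilon fun s : Slice i => ∀ k, s.1 k = t.1 (v k) / mass v t

theorem proj_apply (hv : ∀ i i', v i ≤ v i' → i ≤ i') {i : I} {t : Slice (v i)}
    (h : mass v t ≠ 0) (k : I) : (proj v i t).1 k = t.1 (v k) / mass v t :=
  Classical.epsilon_spec (exists_normalized hv t h) k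

theorem continuousOn_proj (hv : ∀ i i', v i ≤ v i' → i ≤ i') (i : I) :
    ContinuousOn (proj v i) {t | mass v t ≠ 0} := by
  rw [continuousOn_iff_continuous_domRestrict]
  refine continuous_mk fun k => ?_
  simp only [Set.domRestrict_apply]
  have h : ∀ t : {t : Slice (v i) | mass v t ≠ 0},
      (proj v i t.1).1 k = t.1.1 (v k) / mass v t.1 := fun t => proj_apply hv t.2 k
  simp only [h]
  exact ((continuous_coord (v k)).comp continuous_subtype_val).div
    ((continuous_mass v).comp continuous_subtype_val) fun t => t.2

theorem proj_map (hv : ∀ i i', v i ≤ v i' → i ≤ i') {i : I} (s : Slice i) :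
    proj v i (map v i s) = s := by
  refine ext_coord fun k => ?_
  rw [proj_apply hv (by simp [mass_map hv]), mass_map hv, map_apply hv, div_one]

theorem map_proj (hv : ∀ i i', v i ≤ v i' → i ≤ i') {i : I} {t : Slice (v i)}
    (h : mass v t = 1) : map v i (proj v i t) = t := by
  refine ext_coord fun k => ?_
  by_cases hk : k ∈ Set.range v
  · obtain ⟨k, rfl⟩ := hk
    rw [map_apply hv, proj_apply hv (by simp [h]), h, div_one]
  · rw [map_apply_of_notMem _ hk]
    by_contra hne
    exact hk ((mass_eq_one_iff hv t).1 h k (Ne.symm hne))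

theorem proj_incl (hv : ∀ i i', v i ≤ v i' → i ≤ i') {i i' : I} (h : i ≤ i') {t : Slice (v i)}
    (ht : mass v t ≠ 0) : proj v i' (incl (v.monotone h) t) = incl h (proj v i t) := by
  refine ext_coord fun k => ?_
  rw [proj_apply hv (by simpa using ht)]
  exact (proj_apply hv ht k).symm

/-- The weight which the deformation `stretch` gives at time `s` to the vertices outside the range
of `v`, as a function of the mass `b` of the range: at time `1` it vanishes for `1 / 2 ≤ b`, and it
is `1` for `b = 0`. -/
def offWeight (s : unitInterval) (b : ℝ) : ℝ := (1 - s) + s * max (1 - 2 * b) 0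


theorem offWeight_nonneg (s : unitInterval) (b : ℝ) : 0 ≤ offWeight s b :=
  add_nonneg (sub_nonneg.2 s.2.2) (mul_nonneg s.2.1 (le_max_right _ _))

theorem continuous_offWeight : Continuous fun p : unitInterval × ℝ => offWeight p.1 p.2 := by
  unfold offWeight
  fun_prop

theorem totalWeight_pos {s : unitInterval} {b : ℝ} (h₀ : 0 ≤ b) (h₁ : b ≤ 1) :
    0 < b + offWeight s b * (1 - b) := by
  rcases h₀.eq_or_lt with rfl | h
  · simp [offWeight]
  · exact add_pos_of_pos_of_nonneg h (mul_nonneg (offWeight_nonneg s b) (sub_nonneg.2 h₁))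

open Classical in
theorem sum_weight (hv : ∀ i i', v i ≤ v i' → i ≤ i') {j : J} (c : ℝ) (t : Slice j) :
    ∑ k, (if k ∈ Set.range v then 1 else c) * t.1 k = mass v t + c * (1 - mass v t) := by
  have h : ∀ k, (if k ∈ Set.range v then 1 else c) * t.1 k =
      c * t.1 k + (1 - c) * if k ∈ Set.range v then t.1 k else 0 := fun k => by
    split_ifs <;> ring
  simp only [h, Finset.sum_add_distrib, ← Finset.mul_sum, ← mass_eq_sum_ite hv,
    stdSimplex.sum_eq_one]
  ring

open Classical in
/-- The deformation of `|N(J / j)|` that shrinks the weights of the vertices outside the range of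
`v`. It starts at the identity, fixes the points supported on the range of `v`, and at time `1`
moves all points with at least half of their weight on the range of `v` to points supported
there. -/
noncomputable def stretch (hv : ∀ i i', v i ≤ v i' → i ≤ i') (j : J) :
    C(unitInterval × Slice j, Slice j) where
  toFun p := ⟨⟨fun k => (if k ∈ Set.range v then 1 else offWeight p.1 (mass v p.2)) * p.2.1 k /
      (mass v p.2 + offWeight p.1 (mass v p.2) * (1 - mass v p.2)), by
        refine ⟨fun k => div_nonneg (mul_nonneg ?_ (stdSimplex.zero_le _ _))
          (totalWeight_pos (mass_nonneg v _) (mass_le_one hv _)).le, ?_⟩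
        · split_ifs
          exacts [zero_le_one, offWeight_nonneg _ _]
        · rw [← Finset.sum_div, sum_weight hv]
          exact div_self (totalWeight_pos (mass_nonneg v _) (mass_le_one hv _)).ne'⟩, by
      have h : ∀ k, (if k ∈ Set.range v then 1 else offWeight p.1 (mass v p.2)) * p.2.1 k /
          (mass v p.2 + offWeight p.1 (mass v p.2) * (1 - mass v p.2)) ≠ 0 → p.2.1 k ≠ 0 :=
        fun k hk h0 => hk (by simp [h0])
      exact ⟨fun k hk k' hk' hne => p.2.2.1 (h k hk) (h k' hk') hne,
        fun k hk => p.2.2.2 k (h k hk)⟩⟩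
  continuous_toFun := by
    have hm : Continuous fun p : unitInterval × Slice j => mass v p.2 :=
      (continuous_mass v).comp continuous_snd
    have ho : Continuous fun p : unitInterval × Slice j => offWeight p.1 (mass v p.2) :=
      continuous_offWeight.comp (continuous_fst.prodMk hm)
    refine continuous_mk fun k => ?_
    refine Continuous.div (Continuous.mul ?_ ((continuous_coord k).comp continuous_snd))
      (hm.add (ho.mul (continuous_const.sub hm)))
      fun p => (totalWeight_pos (mass_nonneg v _) (mass_le_one hv _)).ne'
    split_ifs
    exacts [continuous_const, ho]

open Classical in
theorem stretch_apply (hv : ∀ i i', v i ≤ v i' → i ≤ i') {j : J} (s : unitInterval) (t : Slice j)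
    (k : J) : (stretch hv j (s, t)).1 k =
      (if k ∈ Set.range v then 1 else offWeight s (mass v t)) * t.1 k /
        (mass v t + offWeight s (mass v t) * (1 - mass v t)) := rfl

theorem stretch_zero (hv : ∀ i i', v i ≤ v i' → i ≤ i') {j : J} (t : Slice j) :
    stretch hv j (0, t) = t := by
  refine ext_coord fun k => ?_
  simp [stretch_apply, offWeight]

theorem stretch_of_mass_eq_one (hv : ∀ i i', v i ≤ v i' → i ≤ i') {j : J} (s : unitInterval)
    {t : Slice j} (h : mass v t = 1) : stretch hv j (s, t) = t := by
  refine ext_coord fun k => ?_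
  rw [stretch_apply, h]
  split_ifs with hk
  · simp
  · have : t.1 k = 0 := by
      by_contra hne
      exact hk ((mass_eq_one_iff hv t).1 h k hne)
    simp [this]

theorem stretch_one (hv : ∀ i i', v i ≤ v i' → i ≤ i') {i : I} {t : Slice (v i)}
    (h : 1 / 2 ≤ mass v t) : stretch hv (v i) (1, t) = map v i (proj v i t) := by
  have ho : offWeight 1 (mass v t) = 0 := by
    simp only [offWeight, Set.Icc.coe_one, sub_self, one_mul, zero_add]
    exact max_eq_right (by linarith)
  refine ext_coord fun k => ?_
  rw [stretch_apply, ho]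
  by_cases hk : k ∈ Set.range v
  · rw [if_pos hk]
    obtain ⟨k, rfl⟩ := hk
    rw [map_apply hv, proj_apply hv (by linarith)]
    simp
  · simp [hk, map_apply_of_notMem _ hk]

end Slice
end HoLim

/-! ### Points of polyhedral coproducts -/

theorem continuous_of_closed_cover {T S : Type*} [TopologicalSpace T] [TopologicalSpace S]
    {F : T → S} {A B : Set T} (hA : IsClosed A) (hB : IsClosed B) (hAB : ∀ a, a ∈ A ∨ a ∈ B)
    (hFA : ContinuousOn F A) (hFB : ContinuousOn F B) : Continuous F := by
  rw [← continuousOn_univ, ← Set.eq_univ_of_forall hAB]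
  exact hFA.union_of_isClosed hFB hA hB

namespace PolyhedralCoproduct

open PtdTop HoLim

variable {ι : Type} [Fintype ι] [DecidableEq ι]
variable {X A : ι → PtdTop.{u}} (f : ∀ i, X i ⟶ A i)
variable {K L K₁ K₂ : PreAbstractSimplicialComplex ι}

/-- The value `φ_σ(t)` of a point `φ` of the polyhedral coproduct, a natural transformation, at a
face `σ` and a point `t` of `|N(J / σ)|`. Its type depends only on the underlying set of `σ`, so
values over different complexes can be compared. -/
noncomputable def app (φ : polyhedralCoproduct f K) (σ : K.FacePosetᵒᵈ) (t : Slice σ) :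
    (wedgeDiagram f).obj (vertices K σ) :=
  φ.1 σ t

theorem app_ext {φ ψ : polyhedralCoproduct f K} (h : ∀ σ t, app f φ σ t = app f ψ σ t) : φ = ψ :=
  Subtype.ext (funext fun σ => ContinuousMap.ext (h σ))

theorem continuous_app (σ : K.FacePosetᵒᵈ) :
    Continuous fun p : polyhedralCoproduct f K × Slice σ => app f p.1 σ p.2 := by
  have h : Continuous fun φ : polyhedralCoproduct f K => φ.1 σ :=
    (continuous_apply σ).comp continuous_subtype_val
  exact continuous_eval.comp ((h.comp continuous_fst).prodMk continuous_snd)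

theorem map_app (φ : polyhedralCoproduct f K) {σ τ : K.FacePosetᵒᵈ} (h : σ ≤ τ) (t : Slice σ) :
    ((wedgeDiagram f).map (homOfLE ((vertices K).monotone h))).toMap (app f φ σ t) =
      app f φ τ (Slice.incl h t) :=
  φ.2 σ τ h t

theorem app_mapOfLE (h : L ≤ K) (φ : polyhedralCoproduct f K) (σ : L.FacePosetᵒᵈ) (t : Slice σ) :
    app f ((mapOfLE f h).toMap φ) σ t = app f φ (faceInclusion h σ) (Slice.map _ σ t) := rfl

/-- A continuous map into a polyhedral coproduct, from its values. -/
noncomputable def ofApp {T : Type*} [TopologicalSpace T]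
    (F : ∀ σ : K.FacePosetᵒᵈ, T → Slice σ → (wedgeDiagram f).obj (vertices K σ))
    (hF : ∀ σ, Continuous fun p : T × Slice σ => F σ p.1 p.2)
    (hF' : ∀ a (σ τ : K.FacePosetᵒᵈ) (h : σ ≤ τ) (t : Slice σ),
      ((wedgeDiagram f).map (homOfLE ((vertices K).monotone h))).toMap (F σ a t) =
        F τ a (Slice.incl h t)) :
    C(T, polyhedralCoproduct f K) where
  toFun a := ⟨fun σ => ⟨F σ a, (hF σ).comp (Continuous.prodMk_right a)⟩, hF' a⟩
  continuous_toFun := Continuous.subtype_mk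
    (continuous_pi fun σ => ContinuousMap.continuous_of_continuous_uncurry _ (hF σ)) _

omit [Fintype ι] [DecidableEq ι] in
theorem reflects_faceInclusion (h : L ≤ K) (σ τ : L.FacePosetᵒᵈ) :
    faceInclusion h σ ≤ faceInclusion h τ → σ ≤ τ := id

omit [Fintype ι] [DecidableEq ι] in
theorem mem_range_faceInclusion (h : L ≤ K) (σ : K.FacePosetᵒᵈ) :
    σ ∈ Set.range (faceInclusion h) ↔
      ((OrderDual.ofDual σ).1 = ∅ ∨ (OrderDual.ofDual σ).1 ∈ L) :=
  ⟨fun ⟨τ, hτ⟩ => hτ ▸ (OrderDual.ofDual τ).2, fun hσ => ⟨OrderDual.toDual ⟨_, hσ⟩, rfl⟩⟩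

/-- A face of `K` that lies in `L`, as a face of `L`. -/
def toSubcomplex (σ : K.FacePosetᵒᵈ)
    (hσ : (OrderDual.ofDual σ).1 = ∅ ∨ (OrderDual.ofDual σ).1 ∈ L) : L.FacePosetᵒᵈ :=
  OrderDual.toDual ⟨(OrderDual.ofDual σ).1, hσ⟩

/-- The point of the slice of a subcomplex obtained from `t` by deleting the faces outside the
subcomplex and normalizing. -/
noncomputable def toSlice (h : L ≤ K) (σ : K.FacePosetᵒᵈ)
    (hσ : (OrderDual.ofDual σ).1 = ∅ ∨ (OrderDual.ofDual σ).1 ∈ L) (t : Slice σ) :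
    Slice (toSubcomplex σ hσ) :=
  Slice.proj (faceInclusion h) (toSubcomplex σ hσ) t

omit [DecidableEq ι] in
theorem toSlice_map (h : L ≤ K) (σ : L.FacePosetᵒᵈ) (t : Slice σ) :
    toSlice h (faceInclusion h σ) (OrderDual.ofDual σ).2 (Slice.map (faceInclusion h) σ t) = t :=
  Slice.proj_map (reflects_faceInclusion h) t

omit [Fintype ι] [DecidableEq ι] in
theorem face_of_subset {σ τ : Finset ι} (hτ : τ = ∅ ∨ τ ∈ L) (h : σ ⊆ τ) : σ = ∅ ∨ σ ∈ L := by
  rcases σ.eq_empty_or_nonempty with hσ | hσ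
  · exact Or.inl hσ
  · rcases hτ with rfl | hτ
    · exact Or.inl (Finset.subset_empty.1 h)
    · exact Or.inr ((L.isRelLowerSet_faces hτ).2 h hσ)

omit [DecidableEq ι] in
/-- If some weight of `t` lies on `cat(L)ᵒᵖ`, which is an upper set of `cat(K)ᵒᵖ`, then `σ` is a
face of `L`. -/
theorem face_of_mass_ne_zero (h : L ≤ K) {σ : K.FacePosetᵒᵈ} {t : Slice σ}
    (ht : Slice.mass (faceInclusion h) t ≠ 0) :
    (OrderDual.ofDual σ).1 = ∅ ∨ (OrderDual.ofDual σ).1 ∈ L := by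
  obtain ⟨τ, hτ⟩ := Slice.exists_le_of_mass_ne_zero _ ht
  exact face_of_subset (OrderDual.ofDual τ).2 hτ

/-! ### Weak path lifting for restriction to a subcomplex -/

section Lifting

variable (h : L ≤ K)

/-- The values of the lift of a path `γ`, at time `p.2`: on the points that `stretch` moves into the
slices of `L`, the values of `γ` are used, with a delay that grows with the weight outside `L`, and
elsewhere those of the start point `x`, on the stretched point. Where the two regions meet, the
delayed time is at most `0`, and `projIcc` makes it `0`. -/
noncomputable def liftApp (σ : K.FacePosetᵒᵈ) (p : PathProblem (mapOfLE f h) × unitInterval)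
    (t : Slice σ) : (wedgeDiagram f).obj (vertices K σ) :=
  open Classical in
  if ht : 1 / 2 ≤ Slice.mass (faceInclusion h) t then
    app f (p.1.1.2 (Set.projIcc 0 1 zero_le_one
        ((p.2 : ℝ) - 2 * (1 - Slice.mass (faceInclusion h) t))))
      (toSubcomplex σ (face_of_mass_ne_zero h (by linarith)))
      (toSlice h σ (face_of_mass_ne_zero h (by linarith)) t)
  else app f p.1.1.1 σ (Slice.stretch (reflects_faceInclusion h) σ (1, t))

/-- At parameter `0` the two formulas in `liftApp` agree. -/
theorem app_start_proj (w : PathProblem (mapOfLE f h)) {σ : K.FacePosetᵒᵈ} {t : Slice σ}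
    (hσ : (OrderDual.ofDual σ).1 = ∅ ∨ (OrderDual.ofDual σ).1 ∈ L)
    (ht : 1 / 2 ≤ Slice.mass (faceInclusion h) t) :
    app f (w.1.2 0) (toSubcomplex σ hσ) (toSlice h σ hσ t) =
      app f w.1.1 σ (Slice.stretch (reflects_faceInclusion h) σ (1, t)) := by
  rw [w.2, app_mapOfLE]
  exact congrArg (app f w.1.1 σ)
    (Slice.stretch_one (i := toSubcomplex σ hσ) (reflects_faceInclusion h) ht).symm

theorem liftApp_of_ge (σ : K.FacePosetᵒᵈ) (p : PathProblem (mapOfLE f h) × unitInterval)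
    (t : Slice σ) (ht : 1 / 2 ≤ Slice.mass (faceInclusion h) t)
    (hσ : (OrderDual.ofDual σ).1 = ∅ ∨ (OrderDual.ofDual σ).1 ∈ L) :
    liftApp f h σ p t = app f (p.1.1.2 (Set.projIcc 0 1 zero_le_one
        ((p.2 : ℝ) - 2 * (1 - Slice.mass (faceInclusion h) t))))
      (toSubcomplex σ hσ) (toSlice h σ hσ t) :=
  dif_pos ht

theorem liftApp_of_le (σ : K.FacePosetᵒᵈ) (p : PathProblem (mapOfLE f h) × unitInterval)
    (t : Slice σ) (ht : Slice.mass (faceInclusion h) t ≤ 1 / 2) :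
    liftApp f h σ p t = app f p.1.1.1 σ (Slice.stretch (reflects_faceInclusion h) σ (1, t)) := by
  by_cases ht' : 1 / 2 ≤ Slice.mass (faceInclusion h) t
  · have hσ := face_of_mass_ne_zero h (t := t) (by linarith)
    rw [liftApp_of_ge f h σ p t ht' hσ,
      Set.projIcc_of_le_left zero_le_one (by linarith [p.2.2.2])]
    exact app_start_proj f h p.1 hσ ht'
  · exact dif_neg ht'

theorem continuous_liftApp (σ : K.FacePosetᵒᵈ) :
    Continuous fun q : (PathProblem (mapOfLE f h) × unitInterval) × Slice σ =>
      liftApp f h σ q.1 q.2 := by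
  have hm : Continuous fun q : (PathProblem (mapOfLE f h) × unitInterval) × Slice σ =>
      Slice.mass (faceInclusion h) q.2 := (Slice.continuous_mass _).comp continuous_snd
  refine continuous_of_closed_cover (isClosed_le continuous_const hm)
    (isClosed_le hm continuous_const) (fun q => le_total (1 / 2 : ℝ) _) ?_ ?_
  · by_cases hσ : (OrderDual.ofDual σ).1 = ∅ ∨ (OrderDual.ofDual σ).1 ∈ L
    · have hγ : Continuous fun q : (PathProblem (mapOfLE f h) × unitInterval) × Slice σ =>
          q.1.1.1.2 (Set.projIcc 0 1 zero_le_one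
            ((q.1.2 : ℝ) - 2 * (1 - Slice.mass (faceInclusion h) q.2))) := by
        refine continuous_eval.comp (Continuous.prodMk (by fun_prop) ?_)
        exact (continuous_projIcc (h := zero_le_one)).comp (by fun_prop)
      have hp := (Slice.continuousOn_proj (reflects_faceInclusion h) (toSubcomplex σ hσ)).comp
        (continuousOn_snd (s := {q : (PathProblem (mapOfLE f h) × unitInterval) × Slice σ |
          1 / 2 ≤ Slice.mass (faceInclusion h) q.2})) (fun q hq =>
            (lt_of_lt_of_le (by norm_num) hq : (0 : ℝ) < _).ne')
      refine ((continuous_app f (toSubcomplex σ hσ)).comp_continuousOn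
        (hγ.continuousOn.prodMk hp)).congr fun q hq => ?_
      exact dif_pos hq
    · refine continuousOn_of_forall_continuousAt fun q hq => absurd ?_ hσ
      exact face_of_mass_ne_zero h (t := q.2) (lt_of_lt_of_le (by norm_num) hq).ne'
  · refine ContinuousOn.congr (Continuous.continuousOn ?_) fun q hq =>
      liftApp_of_le f h σ q.1 q.2 hq
    exact (continuous_app f σ).comp (Continuous.prodMk (by fun_prop)
      ((Slice.stretch _ σ).continuous.comp (by fun_prop)))

theorem map_liftApp (p : PathProblem (mapOfLE f h) × unitInterval) (σ τ : K.FacePosetᵒᵈ)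
    (hστ : σ ≤ τ) (t : Slice σ) :
    ((wedgeDiagram f).map (homOfLE ((vertices K).monotone hστ))).toMap (liftApp f h σ p t) =
      liftApp f h τ p (Slice.incl hστ t) := by
  by_cases ht : 1 / 2 ≤ Slice.mass (faceInclusion h) t
  · have ht₀ : Slice.mass (faceInclusion h) t ≠ 0 := by linarith
    have hσ := face_of_mass_ne_zero h ht₀
    have hτ := face_of_subset hσ hστ
    rw [liftApp_of_ge f h σ p t ht hσ, liftApp_of_ge f h τ p (Slice.incl hστ t) ht hτ]
    refine (map_app f _ (σ := toSubcomplex σ hσ) (τ := toSubcomplex τ hτ) hστ _).trans ?_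
    exact congrArg (app f _ (toSubcomplex τ hτ))
      (Slice.proj_incl (i := toSubcomplex σ hσ) (i' := toSubcomplex τ hτ)
        (reflects_faceInclusion h) hστ ht₀).symm
  · rw [liftApp_of_le f h σ p t (not_le.1 ht).le, liftApp_of_le f h τ p _ (not_le.1 ht).le]
    exact map_app f _ hστ _

/-- Restriction from `cat(K)ᵒᵖ` to `cat(L)ᵒᵖ` has weak path liftings, because the slices of `L` are
deformation retracts of neighbourhoods in the slices of `K`, compatibly. -/
noncomputable def weakPathLifting : WeakPathLifting (mapOfLE f h) where
  lift := ofApp f (liftApp f h) (continuous_liftApp f h) (map_liftApp f h)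
  drift := ofApp f (fun σ p t => app f p.1 σ (Slice.stretch (reflects_faceInclusion h) σ (p.2, t)))
    (fun σ => (continuous_app f σ).comp (Continuous.prodMk (by fun_prop)
      ((Slice.stretch _ σ).continuous.comp (by fun_prop))))
    fun p σ τ hστ t => map_app f p.1 hστ _
  map_lift w s := by
    refine app_ext f fun σ t => ?_
    have hm := Slice.mass_map (reflects_faceInclusion h) t
    refine (liftApp_of_ge f h (faceInclusion h σ) (w, s) (Slice.map _ σ t)
      (by rw [hm]; norm_num) (OrderDual.ofDual σ).2).trans ?_
    rw [toSlice_map, hm, sub_self, mul_zero, sub_zero, Set.projIcc_val]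
    rfl
  map_drift x s := by
    refine app_ext f fun σ t => ?_
    exact congrArg (app f x (faceInclusion h σ)) (Slice.stretch_of_mass_eq_one
      (reflects_faceInclusion h) s (Slice.mass_map (reflects_faceInclusion h) t))
  drift_zero x := by
    refine app_ext f fun σ t => ?_
    exact congrArg (app f x σ) (Slice.stretch_zero (reflects_faceInclusion h) t)
  lift_zero w := by
    refine app_ext f fun σ t => ?_
    change liftApp f h σ (w, 0) t =
      app f w.1.1 σ (Slice.stretch (reflects_faceInclusion h) σ (1, t))
    rcases le_total (1 / 2) (Slice.mass (faceInclusion h) t) with ht | ht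
    · have hσ := face_of_mass_ne_zero h (t := t) (by linarith)
      rw [liftApp_of_ge f h σ (w, 0) t ht hσ, Set.projIcc_of_le_left zero_le_one (by
        have := Slice.mass_le_one (reflects_faceInclusion h) t
        simpa using this)]
      exact app_start_proj f h w hσ ht
    · exact liftApp_of_le f h σ (w, 0) t ht
  lift_pt w s hw := by
    refine app_ext f fun σ t => ?_
    change liftApp f h σ (w, s) t = _
    rcases le_total (1 / 2) (Slice.mass (faceInclusion h) t) with ht | ht
    · rw [liftApp_of_ge f h σ (w, s) t ht (face_of_mass_ne_zero h (t := t) (by linarith)), hw]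
      rfl
    · rw [liftApp_of_le f h σ (w, s) t ht, hw]
      rfl
  drift_pt s := rfl

end Lifting

/-! ### Gluing points over two subcomplexes -/

section Glue

variable (h₁ : K₁ ≤ K) (h₂ : K₂ ≤ K) (hL₁ : L ≤ K₁) (hL₂ : L ≤ K₂)

omit [DecidableEq ι] in
/-- A chain of faces of `K₁ ∪ K₂` lies in `K₁` or in `K₂`, according to where its largest face
lies. -/
theorem mass_eq_one_or (hK : ∀ σ ∈ K, σ ∈ K₁ ∨ σ ∈ K₂) {σ : K.FacePosetᵒᵈ} (t : Slice σ) :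
    Slice.mass (faceInclusion h₁) t = 1 ∨ Slice.mass (faceInclusion h₂) t = 1 := by
  rw [Slice.mass_eq_one_iff (reflects_faceInclusion h₁),
    Slice.mass_eq_one_iff (reflects_faceInclusion h₂)]
  refine or_iff_not_imp_left.2 fun hn => ?_
  push Not at hn
  obtain ⟨ρ, hρ, hρ₁⟩ := hn
  rw [mem_range_faceInclusion] at hρ₁
  have key : ∀ τ : K.FacePosetᵒᵈ, ¬ ((OrderDual.ofDual τ).1 = ∅ ∨ (OrderDual.ofDual τ).1 ∈ K₁) →
      ((OrderDual.ofDual τ).1 = ∅ ∨ (OrderDual.ofDual τ).1 ∈ K₂) := fun τ hτ => by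
    rcases (OrderDual.ofDual τ).2 with h0 | h0
    · exact Or.inl h0
    · exact Or.inr ((hK _ h0).resolve_left fun h => hτ (Or.inr h))
  intro τ hτ
  rw [mem_range_faceInclusion]
  rcases t.2.1.total hρ hτ with hρτ | hτρ
  · exact face_of_subset (key ρ hρ₁) hρτ
  · exact key τ fun hτ₁ => hρ₁ (face_of_subset hτ₁ hτρ)

omit [DecidableEq ι] in
theorem face_of_mass_eq_one (h : L ≤ K) {σ : K.FacePosetᵒᵈ} {t : Slice σ}
    (ht : Slice.mass (faceInclusion h) t = 1) :
    (OrderDual.ofDual σ).1 = ∅ ∨ (OrderDual.ofDual σ).1 ∈ L :=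
  face_of_mass_ne_zero h (ht.trans_ne one_ne_zero)

/-- A point of a slice supported on faces of both `K₁` and `K₂` comes from a slice of their
intersection `L`, so points `x` and `y` with the same restriction to `L` have the same value
there. -/
theorem app_proj_eq (hL : ∀ σ, σ ∈ K₁ → σ ∈ K₂ → σ ∈ L)
    {x : polyhedralCoproduct f K₁} {y : polyhedralCoproduct f K₂}
    (hxy : (mapOfLE f hL₁).toMap x = (mapOfLE f hL₂).toMap y) {σ : K.FacePosetᵒᵈ} {t : Slice σ}
    (ht₁ : Slice.mass (faceInclusion h₁) t = 1) (ht₂ : Slice.mass (faceInclusion h₂) t = 1)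
    (hσ₁ : (OrderDual.ofDual σ).1 = ∅ ∨ (OrderDual.ofDual σ).1 ∈ K₁)
    (hσ₂ : (OrderDual.ofDual σ).1 = ∅ ∨ (OrderDual.ofDual σ).1 ∈ K₂) :
    app f x (toSubcomplex σ hσ₁) (toSlice h₁ σ hσ₁ t) =
      app f y (toSubcomplex σ hσ₂) (toSlice h₂ σ hσ₂ t) := by
  have hcap : ∀ τ : Finset ι, (τ = ∅ ∨ τ ∈ K₁) → (τ = ∅ ∨ τ ∈ K₂) → (τ = ∅ ∨ τ ∈ L) := by
    rintro τ (h | h) (h' | h')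
    exacts [Or.inl h, Or.inl h, Or.inl h', Or.inr (hL τ h h')]
  have hσ := hcap _ hσ₁ hσ₂
  have hw := reflects_faceInclusion (hL₁.trans h₁)
  have ht : Slice.mass (faceInclusion (hL₁.trans h₁)) t = 1 := by
    rw [Slice.mass_eq_one_iff hw]
    intro τ hτ
    rw [mem_range_faceInclusion]
    refine hcap _ ((mem_range_faceInclusion h₁ τ).1 ?_) ((mem_range_faceInclusion h₂ τ).1 ?_)
    · exact (Slice.mass_eq_one_iff (reflects_faceInclusion h₁) t).1 ht₁ τ hτ
    · exact (Slice.mass_eq_one_iff (reflects_faceInclusion h₂) t).1 ht₂ τ hτ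
  obtain ⟨s, rfl⟩ : ∃ s : Slice (toSubcomplex (L := L) σ hσ),
      Slice.map (faceInclusion (hL₁.trans h₁)) _ s = t :=
    ⟨_, Slice.map_proj (i := toSubcomplex σ hσ) hw ht⟩
  have e₁ : Slice.map (faceInclusion (hL₁.trans h₁)) _ s =
      Slice.map (faceInclusion h₁) (toSubcomplex σ hσ₁) (Slice.map (faceInclusion hL₁) _ s) :=
    Subtype.ext (stdSimplex.map_comp_apply (faceInclusion hL₁) (faceInclusion h₁) s.1).symm
  have e₂ : Slice.map (faceInclusion (hL₁.trans h₁)) _ s =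
      Slice.map (faceInclusion h₂) (toSubcomplex σ hσ₂) (Slice.map (faceInclusion hL₂) _ s) :=
    Subtype.ext (stdSimplex.map_comp_apply (faceInclusion hL₂) (faceInclusion h₂) s.1).symm
  have e₁' := (congrArg (Slice.proj (faceInclusion h₁) (toSubcomplex σ hσ₁)) e₁).trans
    (Slice.proj_map (reflects_faceInclusion h₁) _)
  have e₂' := (congrArg (Slice.proj (faceInclusion h₂) (toSubcomplex σ hσ₂)) e₂).trans
    (Slice.proj_map (reflects_faceInclusion h₂) _)
  refine (congrArg (app f x _) e₁').trans (Eq.trans ?_ (congrArg (app f y _) e₂').symm)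
  exact congrArg (fun z => app f z (toSubcomplex σ hσ) s) hxy

/-- The value at `t` of the point glued from `x` over `K₁` and `y` over `K₂`. -/
noncomputable def glueApp (hK : ∀ σ ∈ K, σ ∈ K₁ ∨ σ ∈ K₂) (σ : K.FacePosetᵒᵈ)
    (q : polyhedralCoproduct f K₁ × polyhedralCoproduct f K₂) (t : Slice σ) :
    (wedgeDiagram f).obj (vertices K σ) :=
  open Classical in
  if ht : Slice.mass (faceInclusion h₁) t = 1 then
    app f q.1 (toSubcomplex σ (face_of_mass_eq_one h₁ ht))
      (toSlice h₁ σ (face_of_mass_eq_one h₁ ht) t)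
  else
    app f q.2 (toSubcomplex σ (face_of_mass_eq_one h₂
      ((mass_eq_one_or h₁ h₂ hK t).resolve_left ht)))
      (toSlice h₂ σ (face_of_mass_eq_one h₂ ((mass_eq_one_or h₁ h₂ hK t).resolve_left ht)) t)

variable (hK : ∀ σ ∈ K, σ ∈ K₁ ∨ σ ∈ K₂) (hL : ∀ σ, σ ∈ K₁ → σ ∈ K₂ → σ ∈ L)

theorem glueApp_left (σ : K.FacePosetᵒᵈ)
    (q : polyhedralCoproduct f K₁ × polyhedralCoproduct f K₂) {t : Slice σ}
    (ht : Slice.mass (faceInclusion h₁) t = 1)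
    (hσ : (OrderDual.ofDual σ).1 = ∅ ∨ (OrderDual.ofDual σ).1 ∈ K₁) :
    glueApp f h₁ h₂ hK σ q t = app f q.1 (toSubcomplex σ hσ)
      (toSlice h₁ σ hσ t) :=
  dif_pos ht

include hL in
theorem glueApp_right (σ : K.FacePosetᵒᵈ)
    (q : {q : polyhedralCoproduct f K₁ × polyhedralCoproduct f K₂ //
      (mapOfLE f hL₁).toMap q.1 = (mapOfLE f hL₂).toMap q.2}) {t : Slice σ}
    (ht : Slice.mass (faceInclusion h₂) t = 1)
    (hσ : (OrderDual.ofDual σ).1 = ∅ ∨ (OrderDual.ofDual σ).1 ∈ K₂) :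
    glueApp f h₁ h₂ hK σ q.1 t = app f q.1.2 (toSubcomplex σ hσ)
      (toSlice h₂ σ hσ t) := by
  by_cases ht₁ : Slice.mass (faceInclusion h₁) t = 1
  · rw [glueApp_left f h₁ h₂ hK σ q.1 ht₁ (face_of_mass_eq_one h₁ ht₁)]
    exact app_proj_eq f h₁ h₂ hL₁ hL₂ hL q.2 ht₁ ht _ _
  · exact dif_neg ht₁

theorem continuousOn_app_proj {T : Type*} [TopologicalSpace T] (h : L ≤ K) (σ : K.FacePosetᵒᵈ)
    {F : T × Slice σ → (wedgeDiagram f).obj (vertices K σ)} {z : T → polyhedralCoproduct f L}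
    (hz : Continuous z)
    (hF : ∀ p, Slice.mass (faceInclusion h) p.2 = 1 → ∀ hσ, F p = app f (z p.1)
      (toSubcomplex σ hσ) (toSlice h σ hσ p.2)) :
    ContinuousOn F {p | Slice.mass (faceInclusion h) p.2 = 1} := by
  by_cases hσ : (OrderDual.ofDual σ).1 = ∅ ∨ (OrderDual.ofDual σ).1 ∈ L
  · have hp := (Slice.continuousOn_proj (reflects_faceInclusion h) (toSubcomplex σ hσ)).comp
      (continuousOn_snd (s := {p : T × Slice σ | Slice.mass (faceInclusion h) p.2 = 1}))
      (fun p hp => (Eq.trans_ne hp one_ne_zero))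
    exact ((continuous_app f (toSubcomplex σ hσ)).comp_continuousOn
      ((hz.comp continuous_fst).continuousOn.prodMk hp)).congr fun p hp => hF p hp hσ
  · exact continuousOn_of_forall_continuousAt fun p hp => absurd (face_of_mass_eq_one h hp) hσ

/-- The polyhedral coproduct over `K₁ ∪ K₂` maps homeomorphically to the strict pullback; this is
the inverse map. -/
noncomputable def glue : C({q : polyhedralCoproduct f K₁ × polyhedralCoproduct f K₂ //
    (mapOfLE f hL₁).toMap q.1 = (mapOfLE f hL₂).toMap q.2}, polyhedralCoproduct f K) :=
  ofApp f (fun σ q t => glueApp f h₁ h₂ hK σ q.1 t)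
    (fun σ => continuous_of_closed_cover
      (isClosed_eq ((Slice.continuous_mass (faceInclusion h₁)).comp continuous_snd)
        continuous_const)
      (isClosed_eq ((Slice.continuous_mass (faceInclusion h₂)).comp continuous_snd)
        continuous_const)
      (fun p => mass_eq_one_or h₁ h₂ hK p.2)
      (continuousOn_app_proj f h₁ σ (z := fun q => q.1.1) (by fun_prop) fun p hp hσ =>
        glueApp_left f h₁ h₂ hK σ p.1.1 hp hσ)
      (continuousOn_app_proj f h₂ σ (z := fun q => q.1.2) (by fun_prop) fun p hp hσ =>
        glueApp_right f h₁ h₂ hL₁ hL₂ hK hL σ p.1 hp hσ))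
    fun q σ τ hστ t => by
      rcases mass_eq_one_or h₁ h₂ hK t with ht | ht
      · have hσ := face_of_mass_eq_one h₁ ht
        have hτ := face_of_subset hσ hστ
        rw [glueApp_left f h₁ h₂ hK σ q.1 ht hσ,
          glueApp_left f h₁ h₂ hK τ q.1 (t := Slice.incl hστ t) ht hτ]
        refine (map_app f _ (σ := toSubcomplex σ hσ) (τ := toSubcomplex τ hτ) hστ _).trans ?_
        exact congrArg (app f _ (toSubcomplex τ hτ))
          (Slice.proj_incl (i := toSubcomplex σ hσ) (i' := toSubcomplex τ hτ)
            (reflects_faceInclusion h₁) hστ (ht.trans_ne one_ne_zero)).symm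
      · have hσ := face_of_mass_eq_one h₂ ht
        have hτ := face_of_subset hσ hστ
        rw [glueApp_right f h₁ h₂ hL₁ hL₂ hK hL σ q ht hσ,
          glueApp_right f h₁ h₂ hL₁ hL₂ hK hL τ q (t := Slice.incl hστ t) ht hτ]
        refine (map_app f _ (σ := toSubcomplex σ hσ) (τ := toSubcomplex τ hτ) hστ _).trans ?_
        exact congrArg (app f _ (toSubcomplex τ hτ))
          (Slice.proj_incl (i := toSubcomplex σ hσ) (i' := toSubcomplex τ hτ)
            (reflects_faceInclusion h₂) hστ (ht.trans_ne one_ne_zero)).symm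

include hK hL in
/-- The square of polyhedral coproducts of a union of two simplicial complexes is a homotopy
pullback. -/
theorem isHomotopyPullback_mapOfLE :
    IsHomotopyPullback (mapOfLE f h₂) (mapOfLE f h₁) (mapOfLE f hL₂) (mapOfLE f hL₁) := by
  have w : mapOfLE f h₁ ≫ mapOfLE f hL₁ = mapOfLE f h₂ ≫ mapOfLE f hL₂ := by
    refine PtdTop.hom_ext fun φ => app_ext f fun σ t => ?_
    refine congrArg (app f φ (faceInclusion (hL₁.trans h₁) σ)) (Subtype.ext ?_)
    exact (stdSimplex.map_comp_apply (faceInclusion hL₁) (faceInclusion h₁) t.1).trans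
      (stdSimplex.map_comp_apply (faceInclusion hL₂) (faceInclusion h₂) t.1).symm
  refine isHomotopyPullback_of_weakPathLifting w (weakPathLifting f hL₁)
    (glue f h₁ h₂ hL₁ hL₂ hK hL) ?_ ?_ ?_
  · intro q
    refine app_ext f fun σ t => ?_
    refine (glueApp_left f h₁ h₂ hK (faceInclusion h₁ σ) q.1
      (Slice.mass_map (reflects_faceInclusion h₁) t) (OrderDual.ofDual σ).2).trans ?_
    exact congrArg (app f q.1.1 σ) (Slice.proj_map (reflects_faceInclusion h₁) t)
  · intro q
    refine app_ext f fun σ t => ?_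
    refine (glueApp_right f h₁ h₂ hL₁ hL₂ hK hL (faceInclusion h₂ σ) q
      (Slice.mass_map (reflects_faceInclusion h₂) t) (OrderDual.ofDual σ).2).trans ?_
    exact congrArg (app f q.1.2 σ) (Slice.proj_map (reflects_faceInclusion h₂) t)
  · intro φ q hq
    refine app_ext f fun σ t => ?_
    rcases mass_eq_one_or h₁ h₂ hK t with ht | ht
    · have hσ := face_of_mass_eq_one h₁ ht
      refine (glueApp_left f h₁ h₂ hK σ q.1 ht hσ).trans ?_
      rw [hq]
      exact congrArg (app f φ σ)
        (Slice.map_proj (i := toSubcomplex σ hσ) (reflects_faceInclusion h₁) ht)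
    · have hσ := face_of_mass_eq_one h₂ ht
      refine (glueApp_right f h₁ h₂ hL₁ hL₂ hK hL σ q ht hσ).trans ?_
      rw [hq]
      exact congrArg (app f φ σ)
        (Slice.map_proj (i := toSubcomplex σ hσ) (reflects_faceInclusion h₂) ht)

end Glue

end PolyhedralCoproduct

theorem proposition4p2 (l n m : ℕ) (hl : 1 ≤ l) (hnm : n < m) (hlm : l ≤ m)
    (X A : Set.Icc 1 m → PtdTop.{u}) (f : ∀ i, X i ⟶ A i)
    (K₁ : PreAbstractSimplicialComplex (Set.Icc 1 n))
    (K₂ : PreAbstractSimplicialComplex (Set.Icc l m))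
    (L : PreAbstractSimplicialComplex (Set.Icc l n))
    (K K₁' K₂' L' : PreAbstractSimplicialComplex (Set.Icc 1 m))
    (hK₁' : K₁' = K₁.extend 1 m le_rfl hnm.le)
    (hK₂' : K₂' = K₂.extend 1 m hl le_rfl)
    (hL' : L' = L.extend 1 m hl hnm.le)
    (hL : L' = K₁' ⊓ K₂')
    (hK : K = K₁' ⊔ K₂') :
    PtdTop.IsHomotopyPullback
      (PolyhedralCoproduct.mapOfLE f (hK.symm ▸ le_sup_right : K₂' ≤ K))
      (PolyhedralCoproduct.mapOfLE f (hK.symm ▸ le_sup_left : K₁' ≤ K))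
      (PolyhedralCoproduct.mapOfLE f (hL.symm ▸ inf_le_right : L' ≤ K₂'))
      (PolyhedralCoproduct.mapOfLE f (hL.symm ▸ inf_le_left : L' ≤ K₁')) := by
  refine PolyhedralCoproduct.isHomotopyPullback_mapOfLE f _ _ _ _ ?_ ?_
  · rintro σ hσ
    rw [hK] at hσ
    exact hσ
  · rintro σ h₁ h₂
    rw [hL]
    exact ⟨h₁, h₂⟩
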